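/- Let $d=3$, $\omega=e^{2\pi i/3}$, $\tau=e^{4\pi i/3}$. On $\mathbb{C}^3$ with basis $|j\rangle$, $j\in\mathbb{Z}_3$, let $X|j\rangle=|j+1\rangle$, $Z|j\rangle=\omega^j|j\rangle$, $T_{(z,x)}=\tau^{-zx}Z^zX^x$, $A_{(0,0)}=\sum_j|-j\rangle\langle j|$ and $A_{(z,x)}=T_{(z,x)}A_{(0,0)}T_{(z,x)}^\dagger$; for $\mathbf z,\mathbf x\in\mathbb{Z}_3^n$ let $T_{(\mathbf z,\mathbf x)}=\bigotimes_jT_{(z_j,x_j)}$ and $A_{(\mathbf z,\mathbf x)}=\bigotimes_jA_{(z_j,x_j)}$. The discrete Wigner function of an $n$-qutrit state $\rho$ is $W_\rho(\mathbf z,\mathbf x)=3^{-n}\operatorname{Tr}(A_{(\mathbf z,\mathbf x)}\rho)$. Let $\mathcal E_\lambda(\sigma)=(1-\lambda)\sigma+\lambda\operatorname{Tr}(\sigma)\mathbb I/3$, $0\le\lambda\le1$, be the depolarizing channel. A pure stabilizer state is a unit vector fixed by $3^n$ operators $\omega^{k}T_{\mathbf u}$ with $\mathbf u$ running over a subgroup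 of $\mathbb{Z}_3^n\times\mathbb{Z}_3^n$ (with $k$ depending on $\mathbf u$), and $\mathrm{STAB}_n$ is the convex hull of the corresponding density matrices. The robustness of magic is $\mathcal R(\rho)=\inf\{2a+1: a\ge0,\ \rho=(a+1)\sigma-a\tau',\ \sigma,\tau'\in\mathrm{STAB}_n\}$, and the magic noise threshold is $\lambda_0^*(\rho)=\inf\{\lambda\in[0,1]:\mathcal R(\mathcal E_\lambda^{\otimes n}(\rho))\le1\}$. Let $|\mathrm C^{n-1}Z\rangle=3^{-n/2}\sum_{\mathbf s\in\mathbb{Z}_3^n}\omega^{\prod_js_j}|\mathbf s\rangle$, $\Psi_n=|\mathrm C^{n-1}Z\rangle\langle\mathrm C^{n-1}Z|$, $S=\{3,7,11,\dots\}=\{4m-1:m\ge1\}$, $\lambda_n=1-5^{1/n}3^{-(n+1)/(2n)}$, and $(\mathbf 1,\mathbf 0)=((1,\dots,1),(0,\dots,0))$. Then: 1. For $n\in S$ and $0\le k\le n$, the number $3^n\langle\mathrm C^{n-1}Z|T_{(\mathbf 1,\mathbf 0)}\big(A_{(0,0)}^{\otimes(n-k)}\otimes\mathbb I^{\otimes k}\big)T_{(\mathbf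 1,\mathbf 0)}^\dagger|\mathrm C^{n-1}Z\rangle$ equals the character sum $\sum_{\mathbf s\in\mathbb{Z}_3^n}\omega^{((-1)^{n-k}-1)\prod_{j=1}^ns_j+2\sum_{j=1}^{n-k}s_j}$, and its value is $\tfrac12\big(3-3^{(n+1)/2}\big)$ if $k=0$; $0$ if $k<n$ is odd; $3\cdot2^{k-1}$ if $k\ge2$ is even; and $3^n$ if $k=n$. 2. For $n\in S$ and $0\le\lambda\le1$, $$3^{2n}W_{\mathcal E_\lambda^{\otimes n}(\Psi_n)}(\mathbf 1,\mathbf 0)=-\tfrac12\,3^{\frac{n+1}2}(1-\lambda)^n+\lambda^n+\tfrac34\Big(1-\frac\lambda3\Big)^n+\tfrac34\Big(1-\frac{5\lambda}3\Big)^n .$$ 3. For $n\in S$ and $0\le\lambda<\lambda_n$, $W_{\mathcal E_\lambda^{\otimes n}(\Psi_n)}(\mathbf 1,\mathbf 0)$ is real and negative. Moreover $\lambda_n\to1-3^{-1/2}>0.42$ as $n\to\infty$; hence for every $\lambda'<1-3^{-1/2}$ there is $N$ such that for all $n\in S$ with $n\ge N$ it is negative for all $0\le\lambda\le\lambda'$.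 4. $\lambda_0^*(\Psi_n)\ge\lambda_n$ for every $n\in S$; consequently $\liminf_{n\to\infty,\,n\in S}\lambda_0^*(\Psi_n)\ge1-3^{-1/2}$, and $\lambda_0^*(\Psi_n)\ge0.42$ for all sufficiently large $n\in S$. -/

import Mathlib

open scoped Matrix
open Filter Topology

noncomputable section

namespace QuditMagic

/-- The computational basis labels of `n` qudits of local dimension `d`. -/
abbrev Idx (d n : ℕ) : Type := Fin n → ZMod d

/-- Operators on one qudit `ℂ^d`. -/
abbrev Op1 (d : ℕ) : Type := Matrix (ZMod d) (ZMod d) ℂ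

/-- Operators on `(ℂ^d)^{⊗ n}`, as matrices in the computational basis. -/
abbrev Op (d n : ℕ) : Type := Matrix (Idx d n) (Idx d n) ℂ

/-- The tensor product `M_1 ⊗ ⋯ ⊗ M_n` of one-qudit operators. -/
def tensorOp {d n : ℕ} (M : Fin n → Op1 d) : Op d n :=
  Matrix.of fun s t => ∏ j, M j (s j) (t j)

/-- `|ψ⟩⟨ψ|`. -/
def ketbra {ι : Type*} (ψ : ι → ℂ) : Matrix ι ι ℂ := Matrix.vecMulVec ψ (star ψ)

/-- `⟨ψ| M |ψ⟩`. -/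
def expval {ι : Type*} [Fintype ι] (ψ : ι → ℂ) (M : Matrix ι ι ℂ) : ℂ :=
  star ψ ⬝ᵥ (M *ᵥ ψ)

section Heisenberg

variable (d : ℕ) [NeZero d]

/-- `ω ^ k` for `k ∈ ℤ/d`, where `ω = exp (2 π i / d)`. -/
def omegaPow (k : ZMod d) : ℂ := ZMod.stdAddChar k

/-- `τ = exp ((d + 1) π i / d)`; for odd `d` one has `τ ^ d = 1` and `τ ^ 2 = ω`. -/
def tau : ℂ := Complex.exp ((d + 1) * Real.pi * Complex.I / d)

/-- The shift operator, `X |j⟩ = |j + 1⟩`. -/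
def shiftX : Op1 d := Matrix.of fun i j => if i = j + 1 then 1 else 0

/-- The clock operator, `Z |j⟩ = ω ^ j |j⟩`. -/
def clockZ : Op1 d := Matrix.diagonal fun j => omegaPow d j

/-- The one-qudit Heisenberg-Weyl operator `T_(z,x) = τ ^ (- z x) Z ^ z X ^ x` (`d` odd). -/
def weyl1 (z x : ZMod d) : Op1 d :=
  tau d ^ (-(z * x)).val • (clockZ d ^ z.val * shiftX d ^ x.val)

/-- The one-qudit phase point operator at the origin, `A_(0,0) = ∑ j, |-j⟩⟨j|`. -/
def phasePointZero : Op1 d := Matrix.of fun i j => if i = -j then 1 else 0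

/-- `A_(z,x) = T_(z,x) A_(0,0) T_(z,x)†`. -/
def phasePoint1 (z x : ZMod d) : Op1 d :=
  weyl1 d z x * phasePointZero d * (weyl1 d z x)ᴴ

end Heisenberg

variable {d n : ℕ} [NeZero d]

/-- The `n`-qudit operator `T_(z,x) = ⨂ j, T_(z_j, x_j)`. -/
def weyl (z x : Idx d n) : Op d n := tensorOp fun j => weyl1 d (z j) (x j)

/-- The `n`-qudit phase point operator `A_(z,x) = ⨂ j, A_(z_j, x_j)`. -/
def phasePoint (z x : Idx d n) : Op d n := tensorOp fun j => phasePoint1 d (z j) (x j)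

/-- The discrete Wigner function `W_ρ(z,x) = d⁻ⁿ Tr (A_(z,x) ρ)`. -/
def wigner (ρ : Op d n) (z x : Idx d n) : ℂ :=
  ((d : ℂ) ^ n)⁻¹ * (phasePoint z x * ρ).trace

/-- The one-qudit depolarizing channel `E_lam (σ) = (1 - lam) σ + lam Tr(σ) I / d`. -/
def depol1 (lam : ℝ) (σ : Op1 d) : Op1 d :=
  ((1 - lam : ℝ) : ℂ) • σ + ((lam : ℂ) * σ.trace / (d : ℂ)) • (1 : Op1 d)

/-- The channel `E_lam^{⊗ n}`: the linear map that sends every `|s⟩⟨t|`, which is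
`⨂ j, |s_j⟩⟨t_j|`, to `⨂ j, E_lam (|s_j⟩⟨t_j|)`. -/
def depol (lam : ℝ) (ρ : Op d n) : Op d n :=
  ∑ s : Idx d n, ∑ t : Idx d n,
    ρ s t • tensorOp fun j => depol1 lam (Matrix.single (s j) (t j) (1 : ℂ))

/-- Pure stabilizer states of `n` qudits, `d` an odd prime: the unit vectors that are fixed by
`d ^ n` operators of the form `ω ^ k T_u`, with `u` running over a subgroup of phase space. -/
def IsPureStabilizer (ψ : Idx d n → ℂ) : Prop :=
  star ψ ⬝ᵥ ψ = 1 ∧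
    ∃ L : AddSubgroup (Idx d n × Idx d n), Nat.card L = d ^ n ∧
      ∀ u ∈ L, ∃ k : ZMod d, omegaPow d k • (weyl u.1 u.2 *ᵥ ψ) = ψ

/-- `STAB_n`, the convex hull of the pure stabilizer states. -/
def STAB (d n : ℕ) [NeZero d] : Set (Op d n) :=
  convexHull ℝ {ρ | ∃ ψ : Idx d n → ℂ, IsPureStabilizer ψ ∧ ρ = ketbra ψ}

/-- The robustness of magic, the infimum of `2 a + 1` over all decompositions
`ρ = (a + 1) σ - a τ` with `a ≥ 0` and `σ`, `τ` in `STAB_n`. -/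
def robustness (ρ : Op d n) : EReal :=
  sInf {r : EReal | ∃ a : ℝ, 0 ≤ a ∧ ∃ σ ∈ STAB d n, ∃ τ ∈ STAB d n,
    ρ = (a + 1) • σ - a • τ ∧ r = ((2 * a + 1 : ℝ) : EReal)}

/-- The `ε`-magic noise threshold, the infimum of the noise rates `lam ∈ [0, 1]` at which the
robustness of magic of `E_lam^{⊗ n} (ρ)` is at most `1 + ε`. -/
def magicThreshold (ε : ℝ) (ρ : Op d n) : ℝ :=
  sInf {lam : ℝ | lam ∈ Set.Icc (0 : ℝ) 1 ∧ robustness (depol lam ρ) ≤ ((1 + ε : ℝ) : EReal)}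

/-- `|C^{n-1}Z⟩ = d^{-n/2} ∑ s, ω ^ (∏ j, s_j) |s⟩`. -/
def cnzKet (d n : ℕ) [NeZero d] : Idx d n → ℂ :=
  fun s => ((1 / Real.sqrt ((d : ℝ) ^ n) : ℝ) : ℂ) * omegaPow d (∏ j, s j)

/-- `|C^{n-1}Z⟩⟨C^{n-1}Z|`. -/
def cnz (d n : ℕ) [NeZero d] : Op d n := ketbra (cnzKet d n)

/-- `A_(0,0)^{⊗ (n-k)} ⊗ I^{⊗ k}`: phase point operators on the first `n - k` qudits and the
identity on the last `k`. -/
def partialPhasePointZero (d n k : ℕ) [NeZero d] : Op d n :=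
  tensorOp fun j => if (j : ℕ) < n - k then phasePointZero d else 1

/-- `1 - 5^{1/n} 3^{-(n+1)/(2n)}`. -/
def lamSeq (n : ℕ) : ℝ :=
  1 - (5 : ℝ) ^ (1 / (n : ℝ)) * (3 : ℝ) ^ (-(((n : ℝ) + 1) / (2 * (n : ℝ))))

end QuditMagic

end

open QuditMagic

noncomputable section

namespace QuditMagic

/-! ### Tensor products of one-qudit operators -/

/-! The phase `ω ^ ∏ s_j` does not factor over the qutrits, but on `ZMod 3` the function `ω ^ p` is
a combination of three multiplicative functions: `1`, the indicator of `p ≠ 0` and the quadratic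
character. Expanding bra and ket in them turns any matrix element of a tensor product operator into
nine products of one-qutrit sums (`pow_mul_expval_tensorOp`). Depolarizing noise is self-dual, so it
only replaces `A` by `(1 - λ) A + (λ/3) I`; both the matrix elements and the noisy Wigner function
are specializations of that one formula. In the latter the positive terms total at most `1 + 3/4 +
3/4 = 5/2`, so negativity follows once `3 ^ ((n+1)/2) (1 - λ) ^ n > 5`, which is `λ < lamSeq n`.

For the threshold, pure stabilizer states have nonnegative Wigner function at the points `(w, 0)`
(`IsPureStabilizer.expval_phasePoint_nonneg`): the function is there a character sum over the
stabilizer group. Convexity and a uniform upper bound on `STAB` extend this to all states of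
robustness at most `1`, so a negative value excludes `λ` from the set whose infimum is the
threshold. -/

theorem tensorOp_mul {d n : ℕ} [NeZero d] (M N : Fin n → Op1 d) :
    tensorOp M * tensorOp N = tensorOp fun j => M j * N j := by
  ext s t
  simp only [tensorOp, Matrix.mul_apply, Matrix.of_apply, ← Finset.prod_mul_distrib]
  rw [Finset.prod_univ_sum, Fintype.piFinset_univ]

theorem tensorOp_conjTranspose {d n : ℕ} (M : Fin n → Op1 d) :
    (tensorOp M)ᴴ = tensorOp fun j => (M j)ᴴ := by
  ext s t
  simp [tensorOp, Matrix.conjTranspose_apply]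

theorem trace_tensorOp {d n : ℕ} [NeZero d] (M : Fin n → Op1 d) :
    (tensorOp M).trace = ∏ j, (M j).trace := by
  simp only [tensorOp, Matrix.trace, Matrix.diag_apply, Matrix.of_apply]
  rw [Finset.prod_univ_sum, Fintype.piFinset_univ]

theorem trace_mul_ketbra {ι : Type*} [Fintype ι] (M : Matrix ι ι ℂ) (ψ : ι → ℂ) :
    (M * ketbra ψ).trace = expval ψ M := by
  rw [ketbra, Matrix.mul_vecMulVec, Matrix.trace_vecMulVec, expval, dotProduct_comm]

theorem expval_eq_sum {ι : Type*} [Fintype ι] (ψ : ι → ℂ) (M : Matrix ι ι ℂ) :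
    expval ψ M = ∑ s, ∑ t, star (ψ s) * (M s t * ψ t) := by
  simp [expval, dotProduct, Matrix.mulVec, Finset.mul_sum]

/-! ### The additive character of `ZMod 3` -/

theorem omegaPow_add (a b : ZMod 3) : omegaPow 3 (a + b) = omegaPow 3 a * omegaPow 3 b :=
  AddChar.map_add_eq_mul _ a b

@[simp] theorem omegaPow_zero : omegaPow 3 0 = 1 := AddChar.map_zero_eq_one _

theorem omegaPow_sum {ι : Type*} (s : Finset ι) (f : ι → ZMod 3) :
    omegaPow 3 (∑ i ∈ s, f i) = ∏ i ∈ s, omegaPow 3 (f i) := by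
  induction s using Finset.cons_induction with
  | empty => simp
  | cons a s ha ih => rw [Finset.sum_cons, Finset.prod_cons, omegaPow_add, ih]

theorem star_omegaPow (a : ZMod 3) : star (omegaPow 3 a) = omegaPow 3 (-a) := by
  exact (AddChar.map_neg_eq_conj _ a).symm

theorem omegaPow_neg_mul_self (a : ZMod 3) : omegaPow 3 (-a) * omegaPow 3 a = 1 := by
  rw [← omegaPow_add]; simp

theorem omegaPow_pow (a : ZMod 3) (m : ℕ) : omegaPow 3 a ^ m = omegaPow 3 (m * a) := by
  rw [← nsmul_eq_mul]; exact (AddChar.map_nsmul_eq_pow _ m a).symm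

theorem omegaPow_injective : Function.Injective (omegaPow 3) := ZMod.injective_stdAddChar

theorem omegaPow_one : omegaPow 3 1 = ⟨-1 / 2, Real.sqrt 3 / 2⟩ := by
  have h := ZMod.stdAddChar_coe (N := 3) 1
  have e : (2 * Real.pi * Complex.I * ((1 : ℤ) : ℂ) / ((3 : ℕ) : ℂ) : ℂ)
      = ((Real.pi - Real.pi / 3 : ℝ) : ℂ) * Complex.I := by push_cast; ring
  rw [e, Complex.exp_mul_I, ← Complex.ofReal_cos, ← Complex.ofReal_sin, Real.cos_pi_sub,
    Real.sin_pi_sub, Real.cos_pi_div_three, Real.sin_pi_div_three, Int.cast_one] at h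
  rw [omegaPow, h]
  apply Complex.ext <;> simp
  norm_num

theorem omegaPow_two : omegaPow 3 2 = ⟨-1 / 2, -(Real.sqrt 3 / 2)⟩ := by
  have h := star_omegaPow 1
  rw [show (-1 : ZMod 3) = 2 from rfl, omegaPow_one] at h
  rw [← h]; rfl

theorem tau_three : tau 3 = omegaPow 3 2 := by
  have h := ZMod.stdAddChar_coe (N := 3) 2
  rw [tau, omegaPow]
  refine Eq.trans ?_ h.symm
  congr 1; push_cast; ring

/-! ### Weyl operators -/

theorem clockZ_pow (m : ℕ) : clockZ 3 ^ m = Matrix.diagonal fun j => omegaPow 3 (m * j) := by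
  rw [clockZ, Matrix.diagonal_pow]; congr 1; ext j; simp [omegaPow_pow]

theorem shiftX_pow (m : ℕ) :
    shiftX 3 ^ m = Matrix.of fun i j : ZMod 3 => if i = j + m then (1 : ℂ) else 0 := by
  induction m with
  | zero => ext i j; simp [Matrix.one_apply]
  | succ m ih =>
    rw [pow_succ, ih]
    ext i j
    simp only [shiftX, Matrix.mul_apply, Matrix.of_apply, mul_ite, mul_one, mul_zero]
    rw [Finset.sum_ite_eq' Finset.univ (j + 1)]
    simp [add_assoc, add_comm (1 : ZMod 3)]

theorem weyl1_apply (z x i j : ZMod 3) :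
    weyl1 3 z x i j = if i = j + x then omegaPow 3 (z * i + z * x) else 0 := by
  rw [weyl1, clockZ_pow, shiftX_pow, tau_three, omegaPow_pow]
  simp only [Matrix.smul_apply, Matrix.diagonal_mul, Matrix.of_apply, ZMod.natCast_val,
    ZMod.cast_id', id_eq, smul_eq_mul, mul_ite, mul_one, mul_zero, ← omegaPow_add]
  congr 2
  -- Since `τ = ω ^ 2`, the prefactor contributes `-2zx`, which is `zx` modulo 3.
  have h : (3 : ZMod 3) = 0 := rfl
  linear_combination (-(z * x)) * h

theorem weyl_apply {n : ℕ} (z x s t : Idx 3 n) :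
    weyl z x s t = if s = t + x then omegaPow 3 (z ⬝ᵥ s + z ⬝ᵥ x) else 0 := by
  simp only [weyl, tensorOp, Matrix.of_apply, weyl1_apply]
  rw [Finset.prod_ite_zero]
  simp only [Finset.mem_univ, true_implies, ← omegaPow_sum, Finset.sum_add_distrib]
  simp [funext_iff, dotProduct]

theorem weyl_mulVec {n : ℕ} (z x : Idx 3 n) (ψ : Idx 3 n → ℂ) (s : Idx 3 n) :
    (weyl z x *ᵥ ψ) s = omegaPow 3 (z ⬝ᵥ s + z ⬝ᵥ x) * ψ (s - x) := by
  simp only [Matrix.mulVec, dotProduct, weyl_apply]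
  rw [Finset.sum_eq_single (s - x)]
  · simp
  · intro b _ hb
    rw [if_neg, zero_mul]
    rintro rfl; simp at hb
  · simp

theorem phasePoint1_apply (z i j : ZMod 3) :
    phasePoint1 3 z 0 i j = if i = -j then omegaPow 3 (2 * (z * i)) else 0 := by
  have hw : weyl1 3 z 0 = Matrix.diagonal fun i => omegaPow 3 (z * i) := by
    ext i j
    rw [weyl1_apply, Matrix.diagonal_apply]; simp
  rw [phasePoint1, hw, Matrix.diagonal_conjTranspose, Matrix.mul_diagonal, Matrix.diagonal_mul,
    phasePointZero, Matrix.of_apply, Pi.star_apply, star_omegaPow]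
  split_ifs with h
  · subst h
    rw [mul_one, ← omegaPow_add]; congr 1; ring
  · simp

theorem phasePoint_apply {n : ℕ} (z s t : Idx 3 n) :
    phasePoint z 0 s t = if s = -t then omegaPow 3 (2 * (z ⬝ᵥ s)) else 0 := by
  simp only [phasePoint, tensorOp, Matrix.of_apply, Pi.zero_apply, phasePoint1_apply]
  rw [Finset.prod_ite_zero]
  simp only [Finset.mem_univ, true_implies, ← omegaPow_sum, ← Finset.mul_sum]
  simp [funext_iff, dotProduct]

/-! ### Matrix elements in the hypergraph state -/

/-- The functions `1`, `p ↦ [p ≠ 0]` and the quadratic character on `ZMod 3`: the three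
multiplicative functions that span all functions on `ZMod 3`. -/
def mulFun : Fin 3 → ZMod 3 →* ℂ :=
  ![1,
    (Int.castRingHom ℂ : ℤ →* ℂ).comp
      { toFun := ![0, 1, 1], map_one' := rfl, map_mul' := by decide },
    (Int.castRingHom ℂ : ℤ →* ℂ).comp
      { toFun := ![0, 1, -1], map_one' := rfl, map_mul' := by decide }]

/-- The coefficients of `omegaPow 3` with respect to `mulFun`. -/
def mulCoeff : Fin 3 → ℂ := ![1, -(3 / 2), ⟨0, Real.sqrt 3 / 2⟩]

theorem mulFun_zero_apply (p : ZMod 3) : mulFun 0 p = 1 := rfl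

theorem mulFun_one_zero : mulFun 1 0 = 0 := Int.cast_zero
theorem mulFun_one_one : mulFun 1 1 = 1 := Int.cast_one
theorem mulFun_one_two : mulFun 1 2 = 1 := Int.cast_one
theorem mulFun_two_zero : mulFun 2 0 = 0 := Int.cast_zero
theorem mulFun_two_one : mulFun 2 1 = 1 := Int.cast_one
theorem mulFun_two_two : mulFun 2 2 = -1 := by
  change ((-1 : ℤ) : ℂ) = -1
  simp

theorem sum_zmod_three (f : ZMod 3 → ℂ) : ∑ p, f p = f 0 + f 1 + f 2 := Fin.sum_univ_three f

theorem omegaPow_eq_sum_mulFun (p : ZMod 3) : omegaPow 3 p = ∑ i, mulCoeff i * mulFun i p := by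
  have key : ∀ q : Fin 3, omegaPow 3 (q : ZMod 3) = ∑ i, mulCoeff i * mulFun i (q : ZMod 3) := by
    intro q
    rw [Fin.sum_univ_three]
    fin_cases q
    · change omegaPow 3 0 = _ * mulFun 0 0 + _ * mulFun 1 0 + _ * mulFun 2 0
      rw [mulFun_zero_apply, mulFun_one_zero, mulFun_two_zero]
      simp [mulCoeff]
    · change omegaPow 3 1 = _ * mulFun 0 1 + _ * mulFun 1 1 + _ * mulFun 2 1
      rw [mulFun_zero_apply, mulFun_one_one, mulFun_two_one, omegaPow_one]
      apply Complex.ext <;> simp [mulCoeff]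
      norm_num
    · change omegaPow 3 2 = _ * mulFun 0 2 + _ * mulFun 1 2 + _ * mulFun 2 2
      rw [mulFun_zero_apply, mulFun_one_two, mulFun_two_two, omegaPow_two]
      apply Complex.ext <;> simp [mulCoeff]
      norm_num
  exact key p

/-- Multiplicativity of `g` and `h` distributes them over the qutrits, so the sum over strings
factors. -/
theorem sum_sum_prod_eq {n : ℕ} (g h : ZMod 3 →* ℂ) (G : Fin n → ZMod 3 → ZMod 3 → ℂ) :
    ∑ s : Idx 3 n, ∑ t : Idx 3 n, g (∏ j, s j) * h (∏ j, t j) * ∏ j, G j (s j) (t j) =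
      ∏ j, ∑ p, ∑ q, g p * h q * G j p q := by
  rw [Finset.prod_univ_sum, Fintype.piFinset_univ]
  refine Finset.sum_congr rfl fun s _ => ?_
  rw [Finset.prod_univ_sum, Fintype.piFinset_univ]
  refine Finset.sum_congr rfl fun t _ => ?_
  rw [map_prod, map_prod, ← Finset.prod_mul_distrib, ← Finset.prod_mul_distrib]

theorem pow_mul_expval_cnzKet {n : ℕ} (M : Op 3 n) :
    (3 : ℂ) ^ n * expval (cnzKet 3 n) M =
      ∑ s, ∑ t, omegaPow 3 (-∏ j, s j) * omegaPow 3 (∏ j, t j) * M s t := by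
  rw [expval_eq_sum, Finset.mul_sum]
  refine Finset.sum_congr rfl fun s _ => ?_
  rw [Finset.mul_sum]
  refine Finset.sum_congr rfl fun t _ => ?_
  have h : ((1 / Real.sqrt ((3 : ℝ) ^ n) : ℝ) : ℂ) * ((1 / Real.sqrt ((3 : ℝ) ^ n) : ℝ) : ℂ)
      * 3 ^ n = 1 := by
    rw [← Complex.ofReal_mul, div_mul_div_comm, Real.mul_self_sqrt (by positivity)]
    push_cast
    field_simp
  simp only [cnzKet, star_mul', star_omegaPow]
  rw [show star (((1 / Real.sqrt (((3 : ℕ) : ℝ) ^ n) : ℝ) : ℂ)) = _ from Complex.conj_ofReal _]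
  push_cast at h ⊢
  linear_combination (omegaPow 3 (-∏ j, s j) * omegaPow 3 (∏ j, t j) * M s t) * h

theorem omegaPow_neg_eq_sum_mulFun (p : ZMod 3) :
    omegaPow 3 (-p) = ∑ i, star (mulCoeff i) * mulFun i p := by
  have hr : ∀ i, star (mulFun i p) = mulFun i p := by
    have key : ∀ (i q : Fin 3), star (mulFun i (q : ZMod 3)) = mulFun i (q : ZMod 3) := by
      intro i q
      fin_cases i
      · exact star_one _
      · exact map_intCast (starRingEnd ℂ) _
      · exact map_intCast (starRingEnd ℂ) _
    exact fun i => key i p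
  rw [← star_omegaPow, omegaPow_eq_sum_mulFun, star_sum]
  simp [hr]

/-- The nine local sums. -/
theorem sum_mulFun_phasePoint1 (a b : ℂ) (i k : Fin 3) :
    ∑ p, ∑ q, mulFun i p * mulFun k q * (a • phasePoint1 3 1 0 + b • (1 : Op1 3)) p q =
      (!![3 * b, 2 * b - a, ⟨0, Real.sqrt 3⟩ * a;
        2 * b - a, 2 * b - a, ⟨0, Real.sqrt 3⟩ * a;
        ⟨0, -Real.sqrt 3⟩ * a, ⟨0, -Real.sqrt 3⟩ * a, 2 * b + a] : Matrix (Fin 3) (Fin 3) ℂ) i k := by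
  have n1 : (-1 : ZMod 3) = 2 := rfl
  have n2 : (-2 : ZMod 3) = 1 := rfl
  have n4 : (2 * 2 : ZMod 3) = 1 := rfl
  have d1 : (0 : ZMod 3) ≠ 1 := by decide
  have d2 : (0 : ZMod 3) ≠ 2 := by decide
  have d3 : (1 : ZMod 3) ≠ 2 := by decide
  have c0 : ∀ i, mulFun i 0 = ![1, 0, 0] i := by
    intro i; fin_cases i
    exacts [rfl, mulFun_one_zero, mulFun_two_zero]
  have c1 : ∀ i, mulFun i 1 = 1 := fun i => map_one _
  have c2 : ∀ i, mulFun i 2 = ![1, 1, -1] i := by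
    intro i; fin_cases i
    exacts [rfl, mulFun_one_two, mulFun_two_two]
  simp only [sum_zmod_three, Matrix.add_apply, Matrix.smul_apply, phasePoint1_apply,
    Matrix.one_apply, one_mul, neg_zero, n1, n2, mul_zero, mul_one, n4, if_true, if_neg d1,
    if_neg d2, if_neg d3, if_neg d1.symm, if_neg d2.symm, if_neg d3.symm, smul_eq_mul,
    omegaPow_zero, omegaPow_one, omegaPow_two, c0, c1, c2]
  fin_cases i <;> fin_cases k <;> apply Complex.ext <;> simp <;> ring

/-- The first product is `(-3) ^ ((n+1)/2)`, and `n ≡ 3 (mod 4)` makes this exponent even; the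
second sign comes from `n` odd. This residue fixes the sign of the dominant term. -/
theorem I_sqrt_three_pow {n : ℕ} (hn : n % 4 = 3) :
    (⟨0, Real.sqrt 3⟩ : ℂ) ^ n * ⟨0, Real.sqrt 3⟩ = 3 ^ ((n + 1) / 2) ∧
    (⟨0, -Real.sqrt 3⟩ : ℂ) ^ n * ⟨0, Real.sqrt 3⟩ = -3 ^ ((n + 1) / 2) := by
  obtain ⟨m, rfl⟩ : ∃ m, n = 4 * m + 3 := ⟨n / 4, by omega⟩
  have h3 : Real.sqrt 3 * Real.sqrt 3 = 3 := Real.mul_self_sqrt (by norm_num)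
  have hs : (⟨0, Real.sqrt 3⟩ : ℂ) ^ 2 = -3 := by
    rw [sq]; apply Complex.ext <;> simp [h3]
  have hneg : (⟨0, -Real.sqrt 3⟩ : ℂ) = -⟨0, Real.sqrt 3⟩ := by apply Complex.ext <;> simp
  have he : (4 * m + 3 + 1) / 2 = 2 * (m + 1) := by omega
  have ho : Odd (4 * m + 3) := ⟨2 * m + 1, by ring⟩
  have h1 : (⟨0, Real.sqrt 3⟩ : ℂ) ^ (4 * m + 3) * ⟨0, Real.sqrt 3⟩ = 3 ^ (2 * (m + 1)) := by
    rw [← pow_succ, show 4 * m + 3 + 1 = 2 * (2 * (m + 1)) by ring, pow_mul, hs,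
      (even_two_mul _).neg_pow]
  rw [he, hneg, ho.neg_pow, neg_mul, h1]
  exact ⟨rfl, rfl⟩

/-- The matrix element of `⨂ j, (a j A_(1,0) + b j I)` in the state `|C^{n-1}Z⟩`. -/
theorem pow_mul_expval_tensorOp {n : ℕ} (hn : n % 4 = 3) (a b : Fin n → ℂ) :
    (3 : ℂ) ^ n * expval (cnzKet 3 n)
        (tensorOp fun j => a j • phasePoint1 3 1 0 + b j • (1 : Op1 3)) =
      ∏ j, (3 * b j) - 3 / 4 * ∏ j, (2 * b j - a j) + 3 / 4 * ∏ j, (2 * b j + a j)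
        - 1 / 2 * 3 ^ ((n + 1) / 2) * ∏ j, a j := by
  set G : Fin n → ZMod 3 → ZMod 3 → ℂ :=
    fun j => (a j • phasePoint1 3 1 0 + b j • (1 : Op1 3)) with hG
  have step : (3 : ℂ) ^ n * expval (cnzKet 3 n) (tensorOp G) =
      ∑ i, ∑ k, star (mulCoeff i) * mulCoeff k *
        ∏ j, ∑ p, ∑ q, mulFun i p * mulFun k q * G j p q := by
    simp_rw [pow_mul_expval_cnzKet, omegaPow_neg_eq_sum_mulFun, omegaPow_eq_sum_mulFun,
      ← sum_sum_prod_eq, Finset.sum_mul_sum, Finset.sum_mul, Finset.mul_sum]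
    rw [Finset.sum_comm_cycle]
    refine Finset.sum_congr rfl fun i _ => ?_
    rw [Finset.sum_comm_cycle]
    refine Finset.sum_congr rfl fun k _ => ?_
    refine Finset.sum_congr rfl fun s _ => ?_
    refine Finset.sum_congr rfl fun t _ => ?_
    simp only [tensorOp, Matrix.of_apply]
    ring
  rw [step]
  simp only [hG, sum_mulFun_phasePoint1, Fin.sum_univ_three]
  obtain ⟨h1, h2⟩ := I_sqrt_three_pow hn
  have hc : mulCoeff 2 = ⟨0, Real.sqrt 3⟩ / 2 := by apply Complex.ext <;> simp [mulCoeff]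
  have c0 : mulCoeff 0 = 1 := rfl
  have c1 : mulCoeff 1 = -(3 / 2) := rfl
  have d0 : star (mulCoeff 0) = 1 := star_one _
  have d1 : star (mulCoeff 1) = -(3 / 2) := by apply Complex.ext <;> simp [mulCoeff]
  have d2 : star (mulCoeff 2) = -(⟨0, Real.sqrt 3⟩ / 2) := by
    apply Complex.ext <;> simp [mulCoeff]
  have h3 : (⟨0, Real.sqrt 3⟩ : ℂ) * ⟨0, Real.sqrt 3⟩ = -3 := by
    apply Complex.ext <;> simp
  simp only [d0, d1, d2]
  simp only [hc, c0, c1, Matrix.of_apply, Matrix.cons_val, Finset.prod_mul_distrib,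
    Finset.prod_const, Finset.card_univ, Fintype.card_fin]
  generalize (⟨0, Real.sqrt 3⟩ : ℂ) = r at *
  generalize (⟨0, -Real.sqrt 3⟩ : ℂ) = r' at *
  -- The three entries `2b - a` collect `-3/2 - 3/2 + 9/4 = -3/4`, the entry `2b + a` gets `3/4`,
  -- and each pair of entries with `± i√3 a` gives `-1/4` of `3 ^ ((n+1)/2) ∏ a_j`.
  linear_combination (∏ j, a j) * (-1 / 4 * h1 + 1 / 4 * h2) - 1 / 4 * (∏ j, (2 * b j + a j)) * h3

/-! ### Pure stabilizer states have a nonnegative Wigner function -/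

theorem sum_omegaPow_dotProduct {n : ℕ} (s : Idx 3 n) :
    ∑ z : Idx 3 n, omegaPow 3 (z ⬝ᵥ s) = if s = 0 then 3 ^ n else 0 := by
  have h1 : ∀ a : ZMod 3, ∑ p, omegaPow 3 (p * a) = if a = 0 then (3 : ℂ) else 0 := by
    intro a
    have := AddChar.sum_mulShift (ψ := (ZMod.stdAddChar : AddChar (ZMod 3) ℂ)) a
      (ZMod.isPrimitive_stdAddChar 3)
    simpa [omegaPow] using this
  simp only [dotProduct, omegaPow_sum]
  rw [← Fintype.piFinset_univ, ← Finset.prod_univ_sum (fun _ => Finset.univ)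
    (fun j p => omegaPow 3 (p * s j))]
  simp only [h1]
  rw [Finset.prod_ite_zero]
  simp [funext_iff]

/-- Parseval's identity on `(ZMod 3)^n`, from orthogonality of characters. -/
theorem sum_norm_sq_fourier {n : ℕ} (f : Idx 3 n → ℂ) :
    ∑ z : Idx 3 n, star (∑ s, omegaPow 3 (z ⬝ᵥ s) * f s) * (∑ s, omegaPow 3 (z ⬝ᵥ s) * f s) =
      3 ^ n * ∑ s, star (f s) * f s := by
  simp_rw [star_sum, Finset.sum_mul_sum]
  rw [← Finset.sum_comm_cycle, Finset.mul_sum]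
  refine Finset.sum_congr rfl fun s _ => ?_
  have : ∀ t, ∑ z : Idx 3 n, star (omegaPow 3 (z ⬝ᵥ s) * f s) * (omegaPow 3 (z ⬝ᵥ t) * f t) =
      (if t = s then 3 ^ n else 0) * (star (f s) * f t) := by
    intro t
    have hi : (if t = s then (3 : ℂ) ^ n else 0) = if t - s = 0 then 3 ^ n else 0 := by
      simp only [sub_eq_zero]
    rw [hi, ← sum_omegaPow_dotProduct, Finset.sum_mul]
    refine Finset.sum_congr rfl fun z _ => ?_
    rw [star_mul', star_omegaPow, dotProduct_sub, sub_eq_neg_add, omegaPow_add]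
    ring
  simp_rw [this]
  simp

section

variable {n : ℕ}

theorem expval_weyl (ψ : Idx 3 n → ℂ) (z x : Idx 3 n) :
    expval ψ (weyl z x) =
      omegaPow 3 (z ⬝ᵥ x) * ∑ s, omegaPow 3 (z ⬝ᵥ s) * (star (ψ s) * ψ (s - x)) := by
  rw [expval, dotProduct, Finset.mul_sum]
  refine Finset.sum_congr rfl fun s _ => ?_
  rw [weyl_mulVec, Pi.star_apply, omegaPow_add]
  ring

/-- For fixed `x`, Parseval in `z` applies to `s ↦ conj (ψ s) ψ (s - x)`; the sum over `x` then
splits into two factors of squared norm 1. -/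
theorem sum_expval_weyl_sq (ψ : Idx 3 n → ℂ) (hψ : star ψ ⬝ᵥ ψ = 1) :
    ∑ u : Idx 3 n × Idx 3 n, star (expval ψ (weyl u.1 u.2)) * expval ψ (weyl u.1 u.2) =
      3 ^ n := by
  rw [Fintype.sum_prod_type_right]
  have hx : ∀ x : Idx 3 n, ∑ z, star (expval ψ (weyl z x)) * expval ψ (weyl z x) =
      3 ^ n * ∑ s, (star (ψ s) * ψ s) * (star (ψ (s - x)) * ψ (s - x)) := by
    intro x
    have h := sum_norm_sq_fourier fun s => star (ψ s) * ψ (s - x)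
    refine Eq.trans (Finset.sum_congr rfl fun z _ => ?_)
      (h.trans (congrArg _ (Finset.sum_congr rfl fun s _ => ?_)))
    · rw [expval_weyl, star_mul', star_omegaPow, mul_mul_mul_comm, omegaPow_neg_mul_self, one_mul]
    · rw [star_mul', star_star]; ring
  simp_rw [hx, ← Finset.mul_sum]
  rw [Finset.sum_comm]
  simp_rw [← Finset.mul_sum]
  have hs : ∀ s : Idx 3 n, ∑ x, star (ψ (s - x)) * ψ (s - x) = 1 := by
    intro s
    exact (Fintype.sum_equiv (Equiv.subLeft s) _ (fun t => star (ψ t) * ψ t)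
      (fun _ => rfl)).trans hψ
  simp_rw [hs, mul_one]
  have : ∑ s, star (ψ s) * ψ s = 1 := hψ
  rw [this, mul_one]

/-- Phase point operators are the Fourier transform of the Weyl operators: summing over `z` leaves
only `x = -s`. -/
theorem pow_mul_expval_phasePoint (ψ : Idx 3 n → ℂ) (w : Idx 3 n) :
    3 ^ n * expval ψ (phasePoint w 0) =
      ∑ u : Idx 3 n × Idx 3 n, omegaPow 3 (w ⬝ᵥ u.2) * expval ψ (weyl u.1 u.2) := by
  rw [Fintype.sum_prod_type_right]
  simp_rw [expval_weyl, Finset.mul_sum]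
  rw [Finset.sum_comm_cycle, expval_eq_sum, Finset.mul_sum]
  refine Finset.sum_congr rfl fun s _ => ?_
  have hx : ∀ x : Idx 3 n, ∑ z : Idx 3 n, omegaPow 3 (w ⬝ᵥ x) *
      (omegaPow 3 (z ⬝ᵥ x) * (omegaPow 3 (z ⬝ᵥ s) * (star (ψ s) * ψ (s - x)))) =
      (if x = -s then 3 ^ n else 0) * (omegaPow 3 (w ⬝ᵥ x) * (star (ψ s) * ψ (s - x))) := by
    intro x
    have hi : (if x = -s then (3 : ℂ) ^ n else 0) = if x + s = 0 then 3 ^ n else 0 := by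
      simp only [eq_neg_iff_add_eq_zero]
    rw [hi, ← sum_omegaPow_dotProduct, Finset.sum_mul]
    refine Finset.sum_congr rfl fun z _ => ?_
    rw [dotProduct_add, omegaPow_add]
    ring
  simp_rw [hx]
  rw [Finset.sum_eq_single (-s) (fun t _ h => by
    simp [phasePoint_apply, eq_neg_iff_add_eq_zero, add_comm] at h ⊢
    tauto) (by simp)]
  rw [Finset.sum_eq_single (-s) (by intro t _ h; simp [h]) (by simp)]
  have h3 : (3 : ZMod 3) = 0 := rfl
  have e1 : 2 * (w ⬝ᵥ s) = w ⬝ᵥ (-s) := by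
    rw [dotProduct_neg]; linear_combination (w ⬝ᵥ s) * h3
  have e2 : s - -s = -s := by
    ext j; simp only [Pi.sub_apply, Pi.neg_apply]; linear_combination (s j) * h3
  rw [phasePoint_apply, if_pos (neg_neg s).symm, if_pos rfl, e1, e2]
  ring

/-- Weyl operators compose up to a phase given by the symplectic form; pairing the composition law
with `ψ` turns it into a relation between eigenvalues. -/
theorem expval_weyl_mul {ψ : Idx 3 n → ℂ} (hψ : star ψ ⬝ᵥ ψ = 1) {u v : Idx 3 n × Idx 3 n}
    {a b : ℂ} (hu : weyl u.1 u.2 *ᵥ ψ = a • ψ) (hv : weyl v.1 v.2 *ᵥ ψ = b • ψ) :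
    a * b = omegaPow 3 (v.1 ⬝ᵥ u.2 - u.1 ⬝ᵥ v.2) * expval ψ (weyl (u + v).1 (u + v).2) := by
  have h : weyl u.1 u.2 *ᵥ (weyl v.1 v.2 *ᵥ ψ) =
      omegaPow 3 (v.1 ⬝ᵥ u.2 - u.1 ⬝ᵥ v.2) • (weyl (u + v).1 (u + v).2 *ᵥ ψ) := by
    ext s
    simp only [weyl_mulVec, Pi.smul_apply, smul_eq_mul, ← mul_assoc, ← omegaPow_add]
    congr 2
    · simp only [dotProduct_sub, Prod.fst_add, Prod.snd_add, add_dotProduct, dotProduct_add]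
      have h3 : (3 : ZMod 3) = 0 := rfl
      linear_combination (-(v.1 ⬝ᵥ u.2)) * h3
    · rw [Prod.snd_add]; abel
  rw [hv, Matrix.mulVec_smul, hu, smul_smul] at h
  have h' := congrArg (star ψ ⬝ᵥ ·) h
  simp only [dotProduct_smul, hψ, smul_eq_mul, mul_one] at h'
  rw [mul_comm a b, h', expval]

open scoped ComplexOrder in
-- The expectations `c u` of the Weyl operators form a character on `L` and vanish off `L`. The
-- Fourier formula therefore gives a sum of a character over `L`, which is `0` or `|L|`.
theorem IsPureStabilizer.expval_phasePoint_nonneg {ψ : Idx 3 n → ℂ} (h : IsPureStabilizer ψ)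
    (w : Idx 3 n) : 0 ≤ expval ψ (phasePoint w 0) := by
  classical
  obtain ⟨hψ, L, hL, hfix⟩ := h
  set c : Idx 3 n × Idx 3 n → ℂ := fun u => expval ψ (weyl u.1 u.2) with hc
  have heig : ∀ u ∈ L, weyl u.1 u.2 *ᵥ ψ = c u • ψ ∧ star (c u) * c u = 1 := by
    intro u hu
    obtain ⟨k, hk⟩ := hfix u hu
    have h1 : weyl u.1 u.2 *ᵥ ψ = omegaPow 3 (-k) • ψ := by
      nth_rw 2 [← hk]
      rw [smul_smul, omegaPow_neg_mul_self, one_smul]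
    have h2 : c u = omegaPow 3 (-k) := by
      simp only [hc, expval, h1, dotProduct_smul, hψ, smul_eq_mul, mul_one]
    rw [h2]
    refine ⟨h1, ?_⟩
    rw [star_omegaPow, omegaPow_neg_mul_self]
  have hcard : (Finset.univ.filter (· ∈ L)).card = 3 ^ n := by
    rw [← hL, Nat.card_eq_fintype_card, ← Fintype.card_subtype]
  -- The `3 ^ n` unimodular values on `L` already exhaust the total `3 ^ n` of the squares.
  have hzero : ∀ u, u ∉ L → c u = 0 := by
    have hsum : ∑ u, ‖c u‖ ^ 2 = (3 : ℝ) ^ n := by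
      have := sum_expval_weyl_sq ψ hψ
      have e : ∀ z : ℂ, star z * z = ((‖z‖ ^ 2 : ℝ) : ℂ) := by
        intro z; push_cast; exact Complex.conj_mul' z
      simp_rw [e] at this
      exact_mod_cast this
    rw [← Finset.sum_filter_add_sum_filter_not Finset.univ (· ∈ L)] at hsum
    have h1 : ∑ u with u ∈ L, ‖c u‖ ^ 2 = (3 : ℝ) ^ n := by
      rw [Finset.sum_congr rfl (g := fun _ => (1 : ℝ)), Finset.sum_const, hcard]
      · simp
      · intro u hu
        have := (heig u (Finset.mem_filter.1 hu).2).2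
        have e : star (c u) * c u = ((‖c u‖ ^ 2 : ℝ) : ℂ) := by
          push_cast; exact Complex.conj_mul' _
        rw [e] at this
        exact_mod_cast this
    rw [h1, add_eq_left, Finset.sum_eq_zero_iff_of_nonneg (fun _ _ => by positivity)] at hsum
    intro u hu
    simpa using hsum u (by simp [hu])
  have hmul : ∀ u ∈ L, ∀ v ∈ L, c u * c v = c (u + v) := by
    intro u hu v hv
    have h1 := expval_weyl_mul hψ (heig u hu).1 (heig v hv).1
    have h2 := expval_weyl_mul hψ (heig v hv).1 (heig u hu).1
    have hne : c (u + v) ≠ 0 := by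
      intro h0
      have := (heig _ (L.add_mem hu hv)).2
      simp [h0] at this
    rw [mul_comm (c v), h1, add_comm v u] at h2
    -- Exchanging `u` and `v` negates the symplectic form, so it equals its own negative and
    -- vanishes, as 2 is invertible modulo 3.
    have h3 := omegaPow_injective (mul_right_cancel₀ hne h2)
    have h4 : v.1 ⬝ᵥ u.2 - u.1 ⬝ᵥ v.2 = 0 := by
      have e3 : (3 : ZMod 3) = 0 := rfl
      linear_combination (v.1 ⬝ᵥ u.2 - u.1 ⬝ᵥ v.2) * e3 - h3
    rw [h1, h4, omegaPow_zero, one_mul]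
  set f : Idx 3 n × Idx 3 n → ℂ := fun u => omegaPow 3 (w ⬝ᵥ u.2) * c u with hf
  have hfmul : ∀ u ∈ L, ∀ v ∈ L, f (u + v) = f u * f v := by
    intro u hu v hv
    simp only [hf]
    rw [← hmul u hu v hv, Prod.snd_add, dotProduct_add, omegaPow_add]
    ring
  have hS : (3 : ℂ) ^ n * expval ψ (phasePoint w 0) = ∑ u : L, f u := by
    rw [pow_mul_expval_phasePoint, ← Finset.sum_subtype (Finset.univ.filter (· ∈ L)) (by simp) f,
      Finset.sum_filter_of_ne]
    intro u _ hu
    by_contra hn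
    exact hu (by simp [hf, hzero u hn])
  have hnn : 0 ≤ ∑ u : L, f u := by
    -- If `f v ≠ 1`, translation by `v` multiplies the sum by `f v`, so the sum is zero.
    by_cases hall : ∀ u : L, f u = 1
    · simp [hall]
    · push Not at hall
      obtain ⟨v, hv⟩ := hall
      have : (∑ u : L, f u) * f v = ∑ u : L, f u := by
        rw [Finset.sum_mul]
        refine Fintype.sum_equiv (Equiv.addRight v) _ _ fun u => ?_
        rw [← hfmul u u.2 v v.2]; rfl
      have : (∑ u : L, f u) * (f v - 1) = 0 := by rw [mul_sub, this, mul_one, sub_self]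
      rw [(mul_eq_zero.1 this).resolve_right (sub_ne_zero.2 hv)]
  have hp : (0 : ℂ) ≤ ((3 : ℂ) ^ n)⁻¹ := by simp
  rw [← hS] at hnn
  have := mul_nonneg hp hnn
  rwa [← mul_assoc, inv_mul_cancel₀ (by positivity), one_mul] at this

end

/-! ### The depolarizing channel -/

/-- The depolarizing channel is self-adjoint for the trace pairing, so the noise moves from the
state onto each tensor factor of the observable. -/
theorem trace_tensorOp_mul_depol {d n : ℕ} [NeZero d] (A : Fin n → Op1 d) (lam : ℝ)
    (ρ : Op d n) :
    (tensorOp A * depol lam ρ).trace =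
      (tensorOp (fun j => ((1 - lam : ℝ) : ℂ) • A j +
        ((lam : ℂ) * (A j).trace / d) • (1 : Op1 d)) * ρ).trace := by
  have h1 : ∀ (B : Op1 d) (p q : ZMod d),
      (B * depol1 lam (Matrix.single p q 1)).trace =
        (((1 - lam : ℝ) : ℂ) • B + ((lam : ℂ) * B.trace / d) • (1 : Op1 d)) q p := by
    intro B p q
    rw [depol1, Matrix.mul_add, Matrix.mul_smul, Matrix.mul_smul, Matrix.trace_add,
      Matrix.trace_smul, Matrix.trace_smul, Matrix.trace_mul_comm, Matrix.trace_single_mul,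
      mul_one, Matrix.add_apply, Matrix.smul_apply, Matrix.smul_apply, Matrix.one_apply]
    by_cases h : p = q
    · subst h
      simp [Matrix.trace_single_eq_same]
      ring
    · rw [Matrix.trace_single_eq_of_ne _ _ _ h, if_neg (Ne.symm h)]
      simp
  simp only [depol, Matrix.mul_sum, Matrix.mul_smul, Matrix.trace_sum, Matrix.trace_smul,
    tensorOp_mul, trace_tensorOp, h1]
  rw [Matrix.trace_mul_comm]
  simp [Matrix.trace, Matrix.mul_apply, tensorOp]

theorem depol_one {n : ℕ} (ρ : Op 3 n) :
    depol 1 ρ = (ρ.trace * ((3 : ℂ) ^ n)⁻¹) • (1 : Op 3 n) := by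
  have h : ∀ s t : Idx 3 n,
      (tensorOp fun j => depol1 (1 : ℝ) (Matrix.single (s j) (t j) (1 : ℂ))) =
        if t = s then ((3 : ℂ) ^ n)⁻¹ • (1 : Op 3 n) else 0 := by
    intro s t
    ext p q
    simp only [tensorOp, Matrix.of_apply]
    split_ifs with hst
    · subst hst
      simp only [depol1, Matrix.trace_single_eq_same, Matrix.add_apply, Matrix.smul_apply,
        Matrix.one_apply, smul_eq_mul, mul_ite, mul_one, mul_zero]
      simp only [sub_self, Complex.ofReal_zero, zero_mul, zero_add, Finset.prod_ite_zero,
        Finset.mem_univ, true_implies, funext_iff]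
      simp
    · obtain ⟨j, hj⟩ : ∃ j, t j ≠ s j := by
        by_contra hne; push Not at hne; exact hst (funext hne)
      rw [Matrix.zero_apply]
      refine Finset.prod_eq_zero (Finset.mem_univ j) ?_
      simp [depol1, Matrix.trace_single_eq_of_ne _ _ _ hj.symm]
  simp only [depol, h, smul_ite, smul_zero, Finset.sum_ite_eq', Finset.mem_univ, if_true, smul_smul]
  rw [← Finset.sum_smul, ← Finset.sum_mul]
  rfl

theorem trace_phasePoint1 (z : ZMod 3) : (phasePoint1 3 z 0).trace = 1 := by
  have d1 : (1 : ZMod 3) ≠ 2 := by decide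
  have n1 : (-1 : ZMod 3) = 2 := rfl
  have n2 : (-2 : ZMod 3) = 1 := rfl
  simp [Matrix.trace, sum_zmod_three, phasePoint1_apply, n1, n2, d1, d1.symm]

theorem pow_mul_wigner_depol_cnz {n : ℕ} (hn : n % 4 = 3) (lam : ℝ) :
    (3 : ℂ) ^ (2 * n) * wigner (depol lam (cnz 3 n)) 1 0 =
      ((-(1 / 2) * 3 ^ ((n + 1) / 2) * (1 - lam) ^ n + lam ^ n
        + 3 / 4 * (1 - lam / 3) ^ n + 3 / 4 * (1 - 5 * lam / 3) ^ n : ℝ) : ℂ) := by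
  have hodd : Odd n := ⟨n / 2, by omega⟩
  -- As `A_(1,0)` has trace 1, its image under the noise is `(1 - λ) A + (λ/3) I`.
  have h := pow_mul_expval_tensorOp hn (fun _ => ((1 - lam : ℝ) : ℂ)) (fun _ => (lam : ℂ) / 3)
  simp only [Finset.prod_const, Finset.card_univ, Fintype.card_fin] at h
  have e1 : (2 * ((lam : ℂ) / 3) - ((1 - lam : ℝ) : ℂ)) = -(1 - 5 * lam / 3) := by
    push_cast; ring
  have e2 : (2 * ((lam : ℂ) / 3) + ((1 - lam : ℝ) : ℂ)) = 1 - lam / 3 := by push_cast; ring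
  have e3 : (3 * ((lam : ℂ) / 3)) = lam := by ring
  rw [e1, e2, e3, hodd.neg_pow] at h
  rw [wigner, phasePoint, trace_tensorOp_mul_depol, cnz, trace_mul_ketbra]
  simp only [Pi.one_apply, Pi.zero_apply, trace_phasePoint1, mul_one]
  rw [two_mul, pow_add, mul_assoc]
  push_cast at h ⊢
  rw [mul_inv_cancel_left₀ (pow_ne_zero n (by norm_num)), h]
  ring

theorem wigner_depol_cnz_neg {n : ℕ} (hn : n % 4 = 3) {lam : ℝ} (h0 : 0 ≤ lam)
    (h1 : lam < lamSeq n) :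
    (wigner (depol lam (cnz 3 n)) 1 0).im = 0 ∧ (wigner (depol lam (cnz 3 n)) 1 0).re < 0 := by
  have hn0 : 0 < n := by omega
  have hnR : (n : ℝ) ≠ 0 := by positivity
  set b : ℝ := (5 : ℝ) ^ (1 / (n : ℝ)) * (3 : ℝ) ^ (-(((n : ℝ) + 1) / (2 * (n : ℝ)))) with hb
  have hb0 : 0 < b := by positivity
  have hlt : b < 1 - lam := by
    have : lam < 1 - b := h1
    linarith
  -- `lamSeq` is defined so that the dominant term balances the bound `5/2` on the others exactly at
  -- `1 - λ = b`.
  have hbn : b ^ n * 3 ^ ((n + 1) / 2) = 5 := by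
    have hc : (((n + 1) / 2 : ℕ) : ℝ) = ((n : ℝ) + 1) / 2 := by
      rw [Nat.cast_div (by omega) (by norm_num)]; push_cast; ring
    rw [hb, mul_pow, ← Real.rpow_natCast (5 ^ _), ← Real.rpow_natCast (3 ^ _),
      ← Real.rpow_natCast 3, ← Real.rpow_mul (by norm_num), ← Real.rpow_mul (by norm_num),
      mul_assoc, ← Real.rpow_add (by norm_num), hc]
    rw [show 1 / (n : ℝ) * n = 1 by field_simp,
      show -(((n : ℝ) + 1) / (2 * n)) * n + (n + 1) / 2 = 0 by field_simp; ring]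
    norm_num
  have hpow : 5 < (1 - lam) ^ n * 3 ^ ((n + 1) / 2) := by
    rw [← hbn]
    have := pow_lt_pow_left₀ hlt hb0.le hn0.ne'
    gcongr
  have hneg : -(1 / 2) * 3 ^ ((n + 1) / 2) * (1 - lam) ^ n + lam ^ n
        + 3 / 4 * (1 - lam / 3) ^ n + 3 / 4 * (1 - 5 * lam / 3) ^ n < 0 := by
    have p1 : lam ^ n ≤ 1 := pow_le_one₀ h0 (by linarith)
    have p2 : (1 - lam / 3) ^ n ≤ 1 := pow_le_one₀ (by linarith) (by linarith)
    -- The base can be negative, hence the passage to absolute values.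
    have p3 : (1 - 5 * lam / 3) ^ n ≤ 1 := by
      have : |1 - 5 * lam / 3| ≤ 1 := abs_le.2 ⟨by linarith, by linarith⟩
      calc (1 - 5 * lam / 3) ^ n ≤ |(1 - 5 * lam / 3) ^ n| := le_abs_self _
        _ = |1 - 5 * lam / 3| ^ n := abs_pow _ _
        _ ≤ 1 := pow_le_one₀ (abs_nonneg _) this
    nlinarith
  have h := pow_mul_wigner_depol_cnz hn lam
  generalize -(1 / 2) * 3 ^ ((n + 1) / 2) * (1 - lam) ^ n + lam ^ n
        + 3 / 4 * (1 - lam / 3) ^ n + 3 / 4 * (1 - 5 * lam / 3) ^ n = r at *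
  have hw : wigner (depol lam (cnz 3 n)) 1 0 = ((r / 3 ^ (2 * n) : ℝ) : ℂ) := by
    push_cast
    rw [eq_div_iff (pow_ne_zero _ (by norm_num)), mul_comm, h]
  rw [hw]
  exact ⟨Complex.ofReal_im _, div_neg_of_neg_of_pos hneg (by positivity)⟩

/-! ### The matrix elements of partial phase point operators -/

theorem prod_ite_val_lt {R : Type*} [CommMonoid R] {n m : ℕ} (hm : m ≤ n) (x y : R) :
    ∏ j : Fin n, (if j.val < m then x else y) = x ^ m * y ^ (n - m) := by
  obtain ⟨k, rfl⟩ := Nat.exists_eq_add_of_le hm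
  rw [Fin.prod_univ_add]
  simp

theorem weyl_mul_partialPhasePointZero (n k : ℕ) :
    weyl (1 : Idx 3 n) (0 : Idx 3 n) * partialPhasePointZero 3 n k *
        (weyl (1 : Idx 3 n) (0 : Idx 3 n))ᴴ =
      tensorOp fun j => if j.val < n - k then phasePoint1 3 1 0 else 1 := by
  rw [weyl, partialPhasePointZero, tensorOp_conjTranspose, tensorOp_mul, tensorOp_mul]
  congr 1
  ext1 j
  split_ifs
  · rfl
  · have hw : weyl1 3 1 0 = Matrix.diagonal fun i => omegaPow 3 i := by
      ext i j
      rw [weyl1_apply, Matrix.diagonal_apply]; simp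
    rw [Pi.one_apply, Pi.zero_apply, mul_one, hw, Matrix.diagonal_conjTranspose,
      Matrix.diagonal_mul_diagonal, ← Matrix.diagonal_one]
    congr 1
    ext1 i
    rw [Pi.star_apply, star_omegaPow, mul_comm, omegaPow_neg_mul_self]

theorem pow_mul_expval_partialPhasePointZero_eq_sum (n k : ℕ) :
    (3 : ℂ) ^ n * expval (cnzKet 3 n)
        (weyl (1 : Idx 3 n) (0 : Idx 3 n) * partialPhasePointZero 3 n k *
          (weyl (1 : Idx 3 n) (0 : Idx 3 n))ᴴ) =
      ∑ s : Idx 3 n, omegaPow 3 (((-1) ^ (n - k) - 1) * ∏ j, s j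
        + 2 * ∑ j with j.val < n - k, s j) := by
  rw [weyl_mul_partialPhasePointZero, pow_mul_expval_cnzKet]
  refine Finset.sum_congr rfl fun s _ => ?_
  -- Each row of the operator has one nonzero entry: the column obtained by negating the first `n -
  -- k` coordinates.
  set t₀ : Idx 3 n := fun j => if j.val < n - k then -s j else s j with ht
  have hent : ∀ t : Idx 3 n,
      tensorOp (fun j : Fin n => if j.val < n - k then phasePoint1 3 1 0 else (1 : Op1 3)) s t =
        if t = t₀ then omegaPow 3 (2 * ∑ j with j.val < n - k, s j) else 0 := by
    intro t
    have hj : ∀ j : Fin n,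
        (if j.val < n - k then phasePoint1 3 1 0 else (1 : Op1 3)) (s j) (t j) =
          if t j = t₀ j then omegaPow 3 (if j.val < n - k then 2 * s j else 0) else 0 := by
      intro j
      simp only [ht]
      by_cases h1 : j.val < n - k
      · have h2 : s j = -t j ↔ t j = -s j := eq_neg_iff_add_eq_zero.trans (by
          rw [eq_neg_iff_add_eq_zero, add_comm])
        simp [h1, phasePoint1_apply, h2]
      · simp [h1, Matrix.one_apply, eq_comm]
    simp only [tensorOp, Matrix.of_apply, hj]
    rw [Finset.prod_ite_zero]
    simp only [Finset.mem_univ, true_implies, ← omegaPow_sum, Finset.sum_ite, Finset.sum_const_zero,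
      add_zero, Finset.mul_sum, funext_iff]
  have hprod : ∏ j, t₀ j = (-1) ^ (n - k) * ∏ j, s j := by
    have : ∀ j, t₀ j = (if j.val < n - k then -1 else 1) * s j := by
      intro j; simp only [ht]; split_ifs <;> simp
    simp_rw [this]
    rw [Finset.prod_mul_distrib, prod_ite_val_lt (Nat.sub_le n k), one_pow, mul_one]
  simp only [hent, mul_ite, mul_zero]
  rw [Finset.sum_ite_eq' Finset.univ t₀, if_pos (Finset.mem_univ _), hprod, ← omegaPow_add,
    ← omegaPow_add]
  congr 1
  ring

theorem pow_mul_expval_partialPhasePointZero {n k : ℕ} (hn : n % 4 = 3) (hk : k ≤ n) :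
    (3 : ℂ) ^ n * expval (cnzKet 3 n)
        (weyl (1 : Idx 3 n) (0 : Idx 3 n) * partialPhasePointZero 3 n k *
          (weyl (1 : Idx 3 n) (0 : Idx 3 n))ᴴ) =
      if k = 0 then (1 / 2) * (3 - 3 ^ ((n + 1) / 2))
      else if k = n then 3 ^ n
      else if Odd k then 0
      else 3 * 2 ^ (k - 1) := by
  -- For `0 < k < n` the products of `3b` and of `a` both vanish, leaving `(3/4) 2 ^ k (1 - (-1) ^
  -- (n-k))`.
  have h := pow_mul_expval_tensorOp hn (fun j : Fin n => if j.val < n - k then 1 else 0)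
    (fun j => if j.val < n - k then 0 else 1)
  have e : (fun j : Fin n => (if j.val < n - k then (1 : ℂ) else 0) • phasePoint1 3 1 0 +
      (if j.val < n - k then (0 : ℂ) else 1) • (1 : Op1 3)) =
      fun j => if j.val < n - k then phasePoint1 3 1 0 else 1 := by
    ext1 j; split_ifs <;> simp
  have e1 : ∀ j : Fin n, (3 : ℂ) * (if j.val < n - k then 0 else 1) =
      if j.val < n - k then 0 else 3 := by intro j; split_ifs <;> simp
  have e2 : ∀ j : Fin n, (2 : ℂ) * (if j.val < n - k then 0 else 1) -
      (if j.val < n - k then 1 else 0) = if j.val < n - k then -1 else 2 := by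
    intro j; split_ifs <;> simp
  have e3 : ∀ j : Fin n, (2 : ℂ) * (if j.val < n - k then 0 else 1) +
      (if j.val < n - k then 1 else 0) = if j.val < n - k then 1 else 2 := by
    intro j; split_ifs <;> simp
  simp only [e1, e2, e3] at h
  rw [e, prod_ite_val_lt (Nat.sub_le n k), prod_ite_val_lt (Nat.sub_le n k),
    prod_ite_val_lt (Nat.sub_le n k), prod_ite_val_lt (Nat.sub_le n k), Nat.sub_sub_self hk] at h
  rw [weyl_mul_partialPhasePointZero, h]
  have hodd : Odd n := ⟨n / 2, by omega⟩
  split_ifs with h0 h1 h2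
  · subst h0
    have : n ≠ 0 := by omega
    simp [hodd.neg_pow, this]
    ring
  · subst h1
    simp [h0]
  · have : n - k ≠ 0 := by omega
    have hev : Even (n - k) := Nat.Odd.sub_odd hodd h2
    simp [h0, this, hev.neg_pow]
  · have : n - k ≠ 0 := by omega
    have hod : Odd (n - k) := Nat.Odd.sub_even hk hodd (Nat.not_odd_iff_even.1 h2)
    obtain ⟨m, rfl⟩ := Nat.exists_eq_succ_of_ne_zero h0
    simp [this, hod.neg_pow, pow_succ]
    ring

/-! ### The robustness of magic and the noise threshold -/

/-- The real part of the Wigner function at a point, as a real linear functional. -/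
def wignerRe {n : ℕ} (z x : Idx 3 n) : Op 3 n →ₗ[ℝ] ℝ where
  toFun ρ := (wigner ρ z x).re
  map_add' ρ σ := by simp [wigner, Matrix.trace_add, mul_add]
  map_smul' r ρ := by
    simp only [wigner, Matrix.trace_smul, mul_smul_comm, Complex.smul_re,
      RingHom.id_apply]

theorem norm_apply_le_one {ι : Type*} [Fintype ι] {ψ : ι → ℂ} (h : star ψ ⬝ᵥ ψ = 1) (s : ι) :
    ‖ψ s‖ ≤ 1 := by
  have h1 : ∑ t, ‖ψ t‖ ^ 2 = 1 := by
    have e : ∀ t, star (ψ t) * ψ t = ((‖ψ t‖ ^ 2 : ℝ) : ℂ) := by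
      intro t; push_cast; exact Complex.conj_mul' _
    have h' : ∑ t, star (ψ t) * ψ t = 1 := h
    simp_rw [e] at h'
    exact_mod_cast h'
  have h2 : ‖ψ s‖ ^ 2 ≤ 1 := by
    rw [← h1]
    exact Finset.single_le_sum (f := fun t => ‖ψ t‖ ^ 2) (fun _ _ => by positivity)
      (Finset.mem_univ s)
  exact (sq_le_one_iff₀ (norm_nonneg _)).1 h2

theorem norm_expval_le {ι : Type*} [Fintype ι] {ψ : ι → ℂ} (h : star ψ ⬝ᵥ ψ = 1)
    (M : Matrix ι ι ℂ) : ‖expval ψ M‖ ≤ ∑ s, ∑ t, ‖M s t‖ := by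
  rw [expval_eq_sum]
  refine (norm_sum_le _ _).trans (Finset.sum_le_sum fun s _ => ?_)
  refine (norm_sum_le _ _).trans (Finset.sum_le_sum fun t _ => ?_)
  rw [norm_mul, norm_mul, norm_star]
  have hs := norm_apply_le_one h s
  have ht := norm_apply_le_one h t
  calc ‖ψ s‖ * (‖M s t‖ * ‖ψ t‖) ≤ 1 * (‖M s t‖ * 1) := by gcongr
    _ = ‖M s t‖ := by ring

/-- Nonnegativity and a crude entrywise bound pass from pure stabilizer states to their convex hull,
because the preimage of an interval under a linear functional is convex. -/
theorem exists_wignerRe_mem_Icc {n : ℕ} (w : Idx 3 n) :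
    ∃ C : ℝ, 0 ≤ C ∧ ∀ σ ∈ STAB 3 n, wignerRe w 0 σ ∈ Set.Icc 0 C := by
  refine ⟨∑ s, ∑ t, ‖phasePoint w 0 s t‖, by positivity, fun σ hσ => ?_⟩
  refine convexHull_min ?_ ((convex_Icc (0 : ℝ) _).linear_preimage (wignerRe w 0)) hσ
  rintro _ ⟨ψ, hψ, rfl⟩
  have e : wignerRe w 0 (ketbra ψ) = ((3 : ℝ) ^ n)⁻¹ * (expval ψ (phasePoint w 0)).re := by
    change (wigner (ketbra ψ) w 0).re = _
    rw [wigner, trace_mul_ketbra, ← Complex.re_ofReal_mul]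
    push_cast
    rfl
  have h1 : ((3 : ℝ) ^ n)⁻¹ ≤ 1 := inv_le_one_of_one_le₀ (one_le_pow₀ (by norm_num))
  have h0 : 0 ≤ (expval ψ (phasePoint w 0)).re :=
    (Complex.le_def.1 (hψ.expval_phasePoint_nonneg w)).1
  rw [Set.mem_preimage, e]
  refine ⟨by positivity, ?_⟩
  calc ((3 : ℝ) ^ n)⁻¹ * (expval ψ (phasePoint w 0)).re
      ≤ 1 * (expval ψ (phasePoint w 0)).re := by gcongr
    _ = (expval ψ (phasePoint w 0)).re := one_mul _
    _ ≤ ‖expval ψ (phasePoint w 0)‖ := Complex.re_le_norm _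
    _ ≤ _ := norm_expval_le hψ.1 _

/-- The infimum need not be attained, so decompositions with arbitrarily small `a` are used: each
gives a value at least `-a C`. -/
theorem wignerRe_nonneg_of_robustness_le_one {n : ℕ} {ρ : Op 3 n} (h : robustness ρ ≤ 1)
    (w : Idx 3 n) : 0 ≤ wignerRe w 0 ρ := by
  obtain ⟨C, hC, hS⟩ := exists_wignerRe_mem_Icc w
  by_contra! hneg
  -- With this `δ`, a decomposition with `2a < δ` would force `δ (C + 1) ≤ a C < δ (C + 1)`.
  set δ : ℝ := -wignerRe w 0 ρ / (C + 1) with hδ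
  have hδ0 : 0 < δ := div_pos (by linarith) (by linarith)
  have hlt : robustness ρ < ((1 + δ : ℝ) : EReal) :=
    h.trans_lt (by exact_mod_cast (by linarith : (1 : ℝ) < 1 + δ))
  obtain ⟨_, ⟨a, ha, σ, hσ, τ, hτ, rfl, rfl⟩, hr⟩ := sInf_lt_iff.1 hlt
  have hr' : 2 * a + 1 < 1 + δ := by exact_mod_cast hr
  have h1 := (hS σ hσ).1
  have h2 := (hS τ hτ).2
  rw [map_sub, map_smul, map_smul, smul_eq_mul, smul_eq_mul] at hδ hneg
  have h3 : δ * (C + 1) = -((a + 1) * wignerRe w 0 σ - a * wignerRe w 0 τ) := by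
    rw [hδ]; field_simp
  nlinarith [mul_nonneg (by linarith : 0 ≤ a + 1) h1, mul_le_mul_of_nonneg_left h2 ha]

/-- Basis states are stabilized by the `Z`-type operators, so `L` consists of all `(z, 0)`. -/
theorem isPureStabilizer_single {n : ℕ} (s : Idx 3 n) :
    IsPureStabilizer (Pi.single s (1 : ℂ)) := by
  refine ⟨by simp, (⊤ : AddSubgroup (Idx 3 n)).prod ⊥, ?_, ?_⟩
  · rw [Nat.card_congr (AddSubgroup.prodEquiv _ _).toEquiv, Nat.card_prod]
    simp
  · rintro ⟨z, x⟩ hu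
    have hx : x = 0 := (AddSubgroup.mem_prod.1 hu).2
    subst hx
    refine ⟨-(z ⬝ᵥ s), ?_⟩
    ext t
    simp only [Pi.smul_apply, weyl_mulVec, sub_zero, dotProduct_zero, add_zero, smul_eq_mul]
    by_cases ht : t = s
    · subst ht
      rw [← mul_assoc, omegaPow_neg_mul_self, one_mul]
    · simp [ht]

theorem maximallyMixed_mem_STAB (n : ℕ) : ((3 : ℂ) ^ n)⁻¹ • (1 : Op 3 n) ∈ STAB 3 n := by
  have h := (convex_convexHull ℝ {ρ | ∃ ψ : Idx 3 n → ℂ, IsPureStabilizer ψ ∧ ρ = ketbra ψ}).sum_mem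
    (t := Finset.univ) (w := fun _ : Idx 3 n => ((3 : ℝ) ^ n)⁻¹)
    (z := fun s => ketbra (Pi.single s (1 : ℂ))) (fun _ _ => by positivity)
    (by simp) (fun s _ => subset_convexHull _ _ ⟨_, isPureStabilizer_single s, rfl⟩)
  have e : ∑ s : Idx 3 n, ((3 : ℝ) ^ n)⁻¹ • ketbra (Pi.single s (1 : ℂ)) =
      ((3 : ℂ) ^ n)⁻¹ • (1 : Op 3 n) := by
    ext p q
    rw [← Finset.smul_sum]
    simp [ketbra, Matrix.sum_apply, Matrix.vecMulVec_apply, Matrix.one_apply, Pi.single_apply]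
  rwa [e] at h

theorem trace_cnz (n : ℕ) : (cnz 3 n).trace = 1 := by
  have h := pow_mul_expval_cnzKet (1 : Op 3 n)
  simp only [Matrix.one_apply, mul_ite, mul_one, mul_zero, Finset.sum_ite_eq, Finset.mem_univ,
    if_true, omegaPow_neg_mul_self] at h
  rw [cnz, ← one_mul (ketbra _), trace_mul_ketbra]
  have h3 : (3 : ℂ) ^ n ≠ 0 := pow_ne_zero n (by norm_num)
  apply mul_left_cancel₀ h3
  rw [h]
  simp

/-- Full noise yields the maximally mixed state, which lies in `STAB`. The set is thus nonempty and
its real `sInf` is a genuine infimum rather than the default 0. -/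
theorem one_mem_threshold_set (n : ℕ) :
    (1 : ℝ) ∈ {lam : ℝ | lam ∈ Set.Icc (0 : ℝ) 1 ∧
      robustness (depol lam (cnz 3 n)) ≤ ((1 + 0 : ℝ) : EReal)} := by
  refine ⟨⟨zero_le_one, le_rfl⟩, ?_⟩
  rw [depol_one, trace_cnz, one_mul]
  exact sInf_le ⟨0, le_rfl, _, maximallyMixed_mem_STAB n, _, maximallyMixed_mem_STAB n,
    by simp, by simp⟩

theorem magicThreshold_le_one (n : ℕ) : magicThreshold 0 (cnz 3 n) ≤ 1 :=
  csInf_le ⟨0, fun _ h => h.1.1⟩ (one_mem_threshold_set n)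

theorem lamSeq_le_magicThreshold {n : ℕ} (hn : n % 4 = 3) :
    lamSeq n ≤ magicThreshold 0 (cnz 3 n) := by
  refine le_csInf ⟨1, one_mem_threshold_set n⟩ fun lam ⟨⟨h0, _⟩, hR⟩ => ?_
  by_contra! hlt
  have h1 : 0 ≤ wignerRe 1 0 (depol lam (cnz 3 n)) :=
    wignerRe_nonneg_of_robustness_le_one (by simpa using hR) 1
  exact absurd (wigner_depol_cnz_neg hn h0 hlt).2 (not_lt.2 h1)

/-! ### Asymptotics of the noise rates -/

theorem tendsto_lamSeq : Tendsto lamSeq atTop (𝓝 (1 - (3 : ℝ) ^ (-(1 / 2) : ℝ))) := by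
  have h1 : Tendsto (fun n : ℕ => 1 / (n : ℝ)) atTop (𝓝 0) := tendsto_one_div_atTop_nhds_zero_nat
  have h2 : Tendsto (fun n : ℕ => -(((n : ℝ) + 1) / (2 * (n : ℝ)))) atTop (𝓝 (-(1 / 2))) := by
    have h3 : Tendsto (fun n : ℕ => -(1 / 2 + 1 / 2 * (1 / (n : ℝ)))) atTop
        (𝓝 (-(1 / 2 + 1 / 2 * 0))) := (tendsto_const_nhds.add (h1.const_mul _)).neg
    rw [mul_zero, add_zero] at h3
    refine h3.congr' ?_
    filter_upwards [eventually_gt_atTop 0] with n hn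
    have : (n : ℝ) ≠ 0 := by positivity
    field_simp
  have h5 := (Real.continuousAt_const_rpow (a := 5) (b := 0) (by norm_num)).tendsto.comp h1
  have h6 := (Real.continuousAt_const_rpow (a := 3) (b := -(1 / 2)) (by norm_num)).tendsto.comp h2
  have h7 := (h5.mul h6).const_sub 1
  rw [Real.rpow_zero, one_mul] at h7
  exact h7

theorem lt_one_sub_rpow : (0.42 : ℝ) < 1 - (3 : ℝ) ^ (-(1 / 2) : ℝ) := by
  rw [Real.rpow_neg (by norm_num), ← Real.sqrt_eq_rpow]
  have h : (1.73 : ℝ) < Real.sqrt 3 := Real.lt_sqrt_of_sq_lt (by norm_num)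
  have : (Real.sqrt 3)⁻¹ < (1.73 : ℝ)⁻¹ := by gcongr
  have : (1.73 : ℝ)⁻¹ < 0.58 := by norm_num
  linarith

theorem le_liminf_magicThreshold :
    1 - (3 : ℝ) ^ (-(1 / 2) : ℝ) ≤
      liminf (fun m : ℕ => magicThreshold 0 (cnz 3 (4 * m + 3))) atTop := by
  have hsub : Tendsto (fun m : ℕ => 4 * m + 3) atTop atTop :=
    tendsto_atTop_mono (fun m => by simp only [id]; omega) tendsto_id
  have h := tendsto_lamSeq.comp hsub
  rw [← h.liminf_eq]
  refine liminf_le_liminf (Eventually.of_forall fun m => lamSeq_le_magicThreshold (Nat.mul_add_mod 4 m 3))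
    h.isBoundedUnder_ge ?_
  -- The thresholds are bounded above by 1, which keeps their real `liminf` from being a default
  -- value.
  exact isCoboundedUnder_ge_of_le atTop fun m => magicThreshold_le_one _

end QuditMagic

end

open QuditMagic
theorem mainTheorem8 :
    -- the matrix elements, as character sums over (ℤ/3)^n and in closed form
    (∀ n : ℕ, n % 4 = 3 → ∀ k : ℕ, k ≤ n →
      (3 : ℂ) ^ n * expval (cnzKet 3 n)
          (weyl (1 : Idx 3 n) (0 : Idx 3 n) * partialPhasePointZero 3 n k *
            (weyl (1 : Idx 3 n) (0 : Idx 3 n))ᴴ) =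
          ∑ s : Idx 3 n, omegaPow 3 (((-1) ^ (n - k) - 1) * ∏ j, s j
            + 2 * ∑ j with j.val < n - k, s j) ∧
      (3 : ℂ) ^ n * expval (cnzKet 3 n)
          (weyl (1 : Idx 3 n) (0 : Idx 3 n) * partialPhasePointZero 3 n k *
            (weyl (1 : Idx 3 n) (0 : Idx 3 n))ᴴ) =
        if k = 0 then (1 / 2) * (3 - 3 ^ ((n + 1) / 2))
        else if k = n then 3 ^ n
        else if Odd k then 0
        else 3 * 2 ^ (k - 1)) ∧
    -- the Wigner function of the noisy state at the point (1, 0)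
    (∀ n : ℕ, n % 4 = 3 → ∀ lam : ℝ, 0 ≤ lam → lam ≤ 1 →
      (3 : ℂ) ^ (2 * n) * wigner (depol lam (cnz 3 n)) 1 0 =
        ((-(1 / 2) * 3 ^ ((n + 1) / 2) * (1 - lam) ^ n + lam ^ n
          + 3 / 4 * (1 - lam / 3) ^ n + 3 / 4 * (1 - 5 * lam / 3) ^ n : ℝ) : ℂ)) ∧
    -- its negativity for each n
    (∀ n : ℕ, n % 4 = 3 → ∀ lam : ℝ, 0 ≤ lam → lam < lamSeq n →
      (wigner (depol lam (cnz 3 n)) 1 0).im = 0 ∧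
        (wigner (depol lam (cnz 3 n)) 1 0).re < 0) ∧
    Tendsto lamSeq atTop (𝓝 (1 - (3 : ℝ) ^ (-(1 / 2) : ℝ))) ∧
    (0.42 : ℝ) < 1 - (3 : ℝ) ^ (-(1 / 2) : ℝ) ∧
    -- its negativity for large n, uniformly in the noise rate
    (∀ lam₀ : ℝ, lam₀ < 1 - (3 : ℝ) ^ (-(1 / 2) : ℝ) →
      ∃ N : ℕ, ∀ n : ℕ, N ≤ n → n % 4 = 3 → ∀ lam : ℝ, 0 ≤ lam → lam ≤ lam₀ →
        (wigner (depol lam (cnz 3 n)) 1 0).im = 0 ∧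
          (wigner (depol lam (cnz 3 n)) 1 0).re < 0) ∧
    -- the magic noise threshold
    (∀ n : ℕ, n % 4 = 3 → lamSeq n ≤ magicThreshold 0 (cnz 3 n)) ∧
    1 - (3 : ℝ) ^ (-(1 / 2) : ℝ) ≤
      liminf (fun m : ℕ => magicThreshold 0 (cnz 3 (4 * m + 3))) atTop ∧
    (∃ N : ℕ, ∀ n : ℕ, N ≤ n → n % 4 = 3 →
      (0.42 : ℝ) ≤ magicThreshold 0 (cnz 3 n)) := by
  have hev : ∀ {c : ℝ}, c < 1 - (3 : ℝ) ^ (-(1 / 2) : ℝ) → ∃ N : ℕ, ∀ n, N ≤ n → c < lamSeq n :=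
    fun hc => eventually_atTop.1 (tendsto_lamSeq.eventually (lt_mem_nhds hc))
  refine ⟨fun n hn k hk => ⟨pow_mul_expval_partialPhasePointZero_eq_sum n k,
      pow_mul_expval_partialPhasePointZero hn hk⟩,
    fun n hn lam _ _ => pow_mul_wigner_depol_cnz hn lam,
    fun n hn lam h0 h1 => wigner_depol_cnz_neg hn h0 h1, tendsto_lamSeq, lt_one_sub_rpow,
    fun lam₀ h => ?_, fun n hn => lamSeq_le_magicThreshold hn, le_liminf_magicThreshold, ?_⟩
  · obtain ⟨N, hN⟩ := hev h
    exact ⟨N, fun n hn h3 lam h0 h1 => wigner_depol_cnz_neg h3 h0 (h1.trans_lt (hN n hn))⟩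
  · obtain ⟨N, hN⟩ := hev lt_one_sub_rpow
    exact ⟨N, fun n hn h3 => (hN n hn).le.trans (lamSeq_le_magicThreshold h3)⟩
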